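/- Let $(A,\mathfrak m)$ be an Artinian local ring with infinite residue field, let $d\ge 1$, let $S=\bigoplus_{\mathbf n\in\mathbb N^d}S_{\mathbf n}$ be a finitely generated standard $\mathbb N^d$-graded $A$-algebra (generated over $A$ by elements of total degree $1$), and let $M=\bigoplus_{\mathbf n\in\mathbb N^d}M_{\mathbf n}$ be a finitely generated $\mathbb N^d$-graded $S$-module. "For all large $\mathbf n$" means for all $\mathbf n\ge\mathbf n_0$ (componentwise) for some $\mathbf n_0\in\mathbb N^d$. There is a unique finitely supported family of integers $e(M;\mathbf h)$, $\mathbf h\in\mathbb N^d$, the coefficients of the Hilbert polynomial of $M$, such that for all large $\mathbf n$ the length $\ell_A(M_{\mathbf n})$ is finite and $$\ell_A(M_{\mathbf n})=\sum_{\mathbf h}e(M;\mathbf h)\binom{n_1+h_1}{h_1}\cdots\binom{n_d+h_d}{h_d}.$$ One says that $e(M;\mathbf k)$ is the mixed multiplicity (of maximal degree) of $M$ of type $\mathbf k$ if $e(M;\mathbf h)=0$ for all $\mathbf h\ge\mathbf k$ (componentwise) with $\mathbf h\ne\mathbf k$. Let $S_{++}=\bigoplus_{\mathbf n\ge(1,\dots,1)}S_{\mathbf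 n}$, and for an $S$-module $N$ let $\mathrm{Supp}_{++}N$ be the set of homogeneous prime ideals $P\not\supseteq S_{++}$ of $S$ with $N_P\ne0$; its dimension is the supremum of the lengths of chains of primes in it ($-\infty$ if it is empty). A finite sequence $\mathbf x$ consisting of $k_1$ elements of $S_{\mathbf e_1}$, …, $k_d$ elements of $S_{\mathbf e_d}$ (in any order), where $\mathbf e_i$ is the $i$-th unit vector, is a mixed multiplicity system of $M$ of type $\mathbf k=(k_1,\dots,k_d)$ if $\dim\mathrm{Supp}_{++}(M/\mathbf xM)\le0$. A sequence $x_1,\dots,x_s$ of homogeneous elements of $S$ is $S_{++}$-filter-regular with respect to $M$ if for each $i$, with $M'=M/(x_1,\dots,x_{i-1})M$, one has $(0:_{M'}x_i)_{\mathbf n}=0$ for all large $\mathbf n$. Let $\mathbf x$ be a mixed multiplicity system of $M$ of type $\mathbf k$. Then $e(M;\mathbf k)$ is the mixed multiplicity of $M$ of type $\mathbf k$ (that is, $e(M;\mathbf h)=0$ for all $\mathbf h\ge\mathbf k$, $\mathbf h\neq\mathbf k$), and for all large $\mathbf n$ the length $\ell_A\big[(M/\mathbf xM)_{\mathbf n}\big]$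 is finite and $$e(M;\mathbf k)\le\ell_A\big[(M/\mathbf xM)_{\mathbf n}\big].$$ If moreover $\mathbf x$ is an $S_{++}$-filter-regular sequence with respect to $M$, then $e(M;\mathbf k)=\ell_A\big[(M/\mathbf xM)_{\mathbf n}\big]$ for all large $\mathbf n$. -/

import Mathlib

open Filter

namespace MixedMult

section Graded

variable {d : ℕ} {A S M : Type*} [CommRing A] [CommRing S] [Algebra A S]
  [AddCommGroup M] [Module S M] [Module A M] [IsScalarTower A S M]

/-- The `ℕ^d`-graded `A`-algebra `S = ⨁ S_n` is finitely generated and standard: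
it is generated over `A` by (finitely many) elements of total degree one. -/
def IsStandard (𝒮 : (Fin d → ℕ) → Submodule A S) : Prop :=
  Algebra.FiniteType A S ∧
    Algebra.adjoin A (⋃ i : Fin d, (𝒮 (Pi.single i 1) : Set S)) = ⊤

/-- The ideal `S_{++} = ⨁_{n ≥ (1,…,1)} S_n`, as the ideal generated by the components `S_n`
with `n ≥ (1,…,1)`. -/
def irrelevant (𝒮 : (Fin d → ℕ) → Submodule A S) : Ideal S :=
  Ideal.span (⋃ n : {n : Fin d → ℕ // 1 ≤ n}, (𝒮 n.1 : Set S))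

/-- `Proj S`: the homogeneous prime ideals of `S` which do not contain `S_{++}`. -/
def multiProj (𝒮 : (Fin d → ℕ) → Submodule A S) [GradedAlgebra 𝒮] : Set (PrimeSpectrum S) :=
  {P | P.asIdeal.IsHomogeneous 𝒮 ∧ ¬ irrelevant 𝒮 ≤ P.asIdeal}

/-- `Supp_{++} N = {P ∈ Proj S | N_P ≠ 0}`. -/
def suppPP (𝒮 : (Fin d → ℕ) → Submodule A S) [GradedAlgebra 𝒮]
    (N : Type*) [AddCommGroup N] [Module S N] : Set (PrimeSpectrum S) :=
  {P | P ∈ multiProj 𝒮 ∧ P ∈ Module.support S N}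

/-- `dim Supp_{++} N`, the supremum of the lengths of chains of primes in `Supp_{++} N`; it is
`⊥` (that is, `-∞`) when `Supp_{++} N` is empty. -/
noncomputable def dimSuppPP (𝒮 : (Fin d → ℕ) → Submodule A S) [GradedAlgebra 𝒮]
    (N : Type*) [AddCommGroup N] [Module S N] : WithBot ℕ∞ :=
  Order.krullDim (suppPP 𝒮 N)

/-- The grading `(M / N)_n` of a quotient of a graded module: the image of `M_n` in `M / N`. -/
def quotGrading (𝓜 : (Fin d → ℕ) → Submodule A M) (N : Submodule S M) :
    (Fin d → ℕ) → Submodule A (M ⧸ N) :=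
  fun n => (𝓜 n).map (N.mkQ.restrictScalars A)

/-- The submodule `xM` for a set `X` of elements of `S`: the span of all `x • m`, `x ∈ X`. -/
def idealMul (M : Type*) [AddCommGroup M] [Module S M] (X : Set S) : Submodule S M :=
  Ideal.span X • (⊤ : Submodule S M)

/-- The sequence `x` lies in `⋃ S_{e_i}` and has type `k = (k_1, …, k_d)`: it consists of `k_1`
elements of `S_{e_1}`, …, `k_d` elements of `S_{e_d}`; `c j` records the piece to which the
`j`-th member of the sequence is assigned. -/
def IsOfType (𝒮 : (Fin d → ℕ) → Submodule A S) {s : ℕ} (x : Fin s → S) (k : Fin d → ℕ) : Prop :=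
  ∃ c : Fin s → Fin d, (∀ j, x j ∈ 𝒮 (Pi.single (c j) 1)) ∧
    ∀ i, (Finset.univ.filter fun j => c j = i).card = k i

/-- `x` is a mixed multiplicity system of `M` of type `k`. -/
def IsMixedMultSystem (𝒮 : (Fin d → ℕ) → Submodule A S) [GradedAlgebra 𝒮]
    (M : Type*) [AddCommGroup M] [Module S M] {s : ℕ} (x : Fin s → S) (k : Fin d → ℕ) : Prop :=
  IsOfType 𝒮 x k ∧ dimSuppPP 𝒮 (M ⧸ idealMul M (Set.range x)) ≤ 0

/-- `a` is an `S_{++}`-filter-regular element with respect to the graded module `M`: it is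
homogeneous and `(0 :_M a)_n = 0` for all large `n`. -/
def IsFilterRegularElem (𝒮 : (Fin d → ℕ) → Submodule A S) (𝓜 : (Fin d → ℕ) → Submodule A M)
    (a : S) : Prop :=
  SetLike.IsHomogeneousElem 𝒮 a ∧ ∀ᶠ n in atTop, ∀ m ∈ 𝓜 n, a • m = 0 → m = 0

/-- `x` is an `S_{++}`-filter-regular sequence with respect to `M`: each `x_i` is a filter-regular
element with respect to `M / (x_1, …, x_{i-1})M`. -/
def IsFilterRegularSeq (𝒮 : (Fin d → ℕ) → Submodule A S) (𝓜 : (Fin d → ℕ) → Submodule A M)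
    {s : ℕ} (x : Fin s → S) : Prop :=
  ∀ i : Fin s, IsFilterRegularElem 𝒮 (quotGrading 𝓜 (idealMul M (x '' Set.Iio i))) (x i)

/-- The integer-valued polynomial function `n ↦ ∑_h c_h * binom(n + h, h)`, where
`binom(n + h, h) = ∏_i binom(n_i + h_i, h_i)`. -/
def binomPoly (c : (Fin d → ℕ) →₀ ℤ) (n : Fin d → ℕ) : ℤ :=
  c.sum fun h a => a * ∏ i, ((n i + h i).choose (h i) : ℤ)

/-- `c` is the family of coefficients of the Hilbert polynomial
`P_M(n) = ∑_h c_h * binom(n + h, h)`, that is, `M_n` has finite length over `A`, equal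
to this polynomial, for all large `n`. -/
def IsHilbertCoeff (𝓜 : (Fin d → ℕ) → Submodule A M) (c : (Fin d → ℕ) →₀ ℤ) : Prop :=
  ∀ᶠ n in atTop, ∃ l : ℕ, Module.length A (𝓜 n) = l ∧ (l : ℤ) = binomPoly c n

open Classical in
/-- The coefficients `e(M; h)` of the Hilbert polynomial of the graded module `M` with respect
to the polynomials `binom(n + h, h)` (zero if there were no Hilbert polynomial). -/
noncomputable def mixedCoeff (𝓜 : (Fin d → ℕ) → Submodule A M) : (Fin d → ℕ) →₀ ℤ :=
  if h : ∃ c, IsHilbertCoeff 𝓜 c then h.choose else 0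

/-- `e(M; k)` is the mixed multiplicity (of maximal degree) of `M` of type `k`:
`e(M; h) = 0` for all `h > k`, meaning `h ≥ k` componentwise and `h ≠ k`. -/
def MixedMultDefined (𝓜 : (Fin d → ℕ) → Submodule A M) (k : Fin d → ℕ) : Prop :=
  ∀ h, k < h → mixedCoeff 𝓜 h = 0

end Graded

end MixedMult

set_option linter.unusedSectionVars false

/-! Everything is done for subquotients `L / N` of `M`, with `N ≤ L` homogeneous, because the
argument passes to kernels as well as quotients. For `x` of degree `e_i`, multiplication by `x`
relates the Hilbert functions of `L / N`, `L / (N + xL)` and `(N :_L x) / N` (`hilb_add`). In the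
binomial basis a difference in direction `i` is an index shift, so their coefficients `a`, `b`, `e`
satisfy `shift i a = b - (e - shift i e)` (`IsSubquotCoeff.shift_eq`).

Since the residue field is infinite, each degree `e_i` contains an `x` outside the relevant
associated primes of `L / N` (`exists_notMem_associatedPrimes`), hence filter-regular; then `(N :_L
x) / N` vanishes in large degrees and cutting by `x` just shifts coefficients. This yields Hilbert
polynomials (`exists_isSubquotCoeff`), nonnegativity of coefficients with nothing above them
(`IsSubquotCoeff.nonneg`), and constancy of the polynomial when the relevant support has dimension
at most zero (`IsSubquotCoeff.eq_single_of_isDimZero`).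

The inequality follows by induction on the system (`isSubquotCoeff_le_of_isDimZero`). The remaining
elements serve both `L / (N + xL)` and `(N :_L x) / N`, so for the remaining type `k` the formula
becomes `a (k + e_i) = b k - e k`, and `e k ≥ 0`. For a filter-regular system every step is a pure
shift, which gives equality. -/

namespace MixedMult

/-! ### Numerical polynomials in the binomial basis. -/

section Numeric

variable {d : ℕ}

/-- The shift of a family of coefficients by the `i`-th unit vector. -/
noncomputable def shift (i : Fin d) (c : (Fin d → ℕ) →₀ ℤ) : (Fin d → ℕ) →₀ ℤ :=
  c.comapDomain (· + Pi.single i 1) (add_left_injective _).injOn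

@[simp] lemma shift_apply (i : Fin d) (c : (Fin d → ℕ) →₀ ℤ) (h : Fin d → ℕ) :
    shift i c h = c (h + Pi.single i 1) := rfl

lemma exists_eq_add_single {h : Fin d → ℕ} (hh : h ≠ 0) :
    ∃ (i : Fin d) (h' : Fin d → ℕ), h = h' + Pi.single i 1 := by
  obtain ⟨i, hi⟩ := Function.ne_iff.1 hh
  refine ⟨i, h - Pi.single i 1, (tsub_add_cancel_of_le ?_).symm⟩
  intro j
  rcases eq_or_ne j i with rfl | hj
  · simpa using Nat.one_le_iff_ne_zero.2 hi
  · simp [hj]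

lemma add_single_ne_zero (h : Fin d → ℕ) (i : Fin d) : h + Pi.single i 1 ≠ 0 := by
  intro e
  simpa using congrFun e i

lemma eventually_add_iff (e : Fin d → ℕ) {p : (Fin d → ℕ) → Prop} :
    (∀ᶠ n in atTop, p (n + e)) ↔ ∀ᶠ n in atTop, p n := by
  simp only [eventually_atTop]
  constructor
  · rintro ⟨a, ha⟩
    refine ⟨a + e, fun n hn => ?_⟩
    have := ha (n - e) (le_tsub_of_add_le_right hn)
    rwa [tsub_add_cancel_of_le (le_of_add_le_right hn)] at this
  · rintro ⟨a, ha⟩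
    exact ⟨a, fun n hn => ha _ (le_add_right hn)⟩

lemma binomPoly_add (c c' : (Fin d → ℕ) →₀ ℤ) (n : Fin d → ℕ) :
    binomPoly (c + c') n = binomPoly c n + binomPoly c' n :=
  Finsupp.sum_add_index' (by simp) (by intros; ring)

@[simp] lemma binomPoly_zero (n : Fin d → ℕ) : binomPoly (0 : (Fin d → ℕ) →₀ ℤ) n = 0 :=
  Finsupp.sum_zero_index

lemma binomPoly_single (h : Fin d → ℕ) (a : ℤ) (n : Fin d → ℕ) :
    binomPoly (Finsupp.single h a) n = a * ∏ i, ((n i + h i).choose (h i) : ℤ) :=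
  Finsupp.sum_single_index (by simp)

lemma binomPoly_neg (c : (Fin d → ℕ) →₀ ℤ) (n : Fin d → ℕ) :
    binomPoly (-c) n = -binomPoly c n := by
  have := binomPoly_add c (-c) n
  rw [add_neg_cancel, binomPoly_zero] at this
  linarith

lemma binomPoly_sub (c c' : (Fin d → ℕ) →₀ ℤ) (n : Fin d → ℕ) :
    binomPoly (c - c') n = binomPoly c n - binomPoly c' n := by
  rw [sub_eq_add_neg, binomPoly_add, binomPoly_neg, sub_eq_add_neg]

@[simp] lemma binomPoly_single_zero (a : ℤ) (n : Fin d → ℕ) :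
    binomPoly (Finsupp.single 0 a) n = a := by
  simp [binomPoly_single]

lemma shift_add (i : Fin d) (c c' : (Fin d → ℕ) →₀ ℤ) :
    shift i (c + c') = shift i c + shift i c' := by
  ext; simp

/-- Pascal's rule in the `i`-th variable. The difference is naturally evaluated at `n + e_i`, which
matches the degree in which `L / (N + xL)` appears. -/
lemma binomPoly_add_single (i : Fin d) (c : (Fin d → ℕ) →₀ ℤ) (n : Fin d → ℕ) :
    binomPoly c (n + Pi.single i 1) =
      binomPoly c n + binomPoly (shift i c) (n + Pi.single i 1) := by
  induction c using Finsupp.induction_linear with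
  | zero =>
    have : shift i (0 : (Fin d → ℕ) →₀ ℤ) = 0 := by ext; simp
    simp [this]
  | add f g hf hg =>
    rw [shift_add]
    simp only [binomPoly_add, hf, hg]
    ring
  | single h a =>
    have hprod : ∀ (h m : Fin d → ℕ), ∏ j, ((m j + h j).choose (h j) : ℤ) =
        ((m i + h i).choose (h i) : ℤ) *
          ∏ j ∈ Finset.univ.erase i, ((m j + h j).choose (h j) : ℤ) :=
      fun h m => (Finset.mul_prod_erase _ _ (Finset.mem_univ i)).symm
    have herase : ∀ (h : Fin d → ℕ) (g : Fin d → ℕ → ℕ → ℤ),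
        ∏ j ∈ Finset.univ.erase i, g j (n j) ((h + Pi.single i 1 : Fin d → ℕ) j) =
        ∏ j ∈ Finset.univ.erase i, g j ((n + Pi.single i 1 : Fin d → ℕ) j) (h j) := by
      intro h g
      refine Finset.prod_congr rfl fun j hj => ?_
      simp [(Finset.mem_erase.1 hj).1]
    by_cases hi : h i = 0
    · have hs : shift i (Finsupp.single h a) = 0 := by
        ext g
        rw [shift_apply, Finsupp.single_apply, if_neg, Finsupp.zero_apply]
        rintro rfl
        simp at hi
      rw [hs, binomPoly_zero, add_zero, binomPoly_single, binomPoly_single]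
      congr 1
      refine Finset.prod_congr rfl fun j _ => ?_
      rcases eq_or_ne j i with rfl | hj
      · simp [hi]
      · simp [hj]
    · obtain ⟨h, rfl⟩ : ∃ h', h = h' + Pi.single i 1 := by
        refine ⟨h - Pi.single i 1, (tsub_add_cancel_of_le ?_).symm⟩
        intro j
        rcases eq_or_ne j i with rfl | hj
        · simpa using Nat.one_le_iff_ne_zero.2 hi
        · simp [hj]
      have hs : shift i (Finsupp.single (h + Pi.single i 1) a) = Finsupp.single h a := by
        ext g
        simp [Finsupp.single_apply]
      rw [hs]
      simp only [binomPoly_single]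
      rw [hprod, hprod (h + Pi.single i 1) n, hprod h]
      have e1 := herase h fun _ m k => ((m + k).choose k : ℤ)
      have e2 : ∏ j ∈ Finset.univ.erase i, (((n + Pi.single i 1 : Fin d → ℕ) j +
          (h + Pi.single i 1 : Fin d → ℕ) j).choose ((h + Pi.single i 1 : Fin d → ℕ) j) : ℤ) =
          ∏ j ∈ Finset.univ.erase i,
          (((n + Pi.single i 1 : Fin d → ℕ) j + h j).choose (h j) : ℤ) := by
        refine Finset.prod_congr rfl fun j hj => ?_
        simp [(Finset.mem_erase.1 hj).1]
      rw [e1, e2]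
      have e3 := Nat.choose_succ_succ (n i + h i + 1) (h i)
      have e4 : (((n + Pi.single i 1 : Fin d → ℕ) i +
          (h + Pi.single i 1 : Fin d → ℕ) i).choose ((h + Pi.single i 1 : Fin d → ℕ) i) : ℤ) =
          ((n i + (h + Pi.single i 1 : Fin d → ℕ) i).choose
            ((h + Pi.single i 1 : Fin d → ℕ) i) : ℤ) +
          (((n + Pi.single i 1 : Fin d → ℕ) i + h i).choose (h i) : ℤ) := by
        simp only [Pi.add_apply, Pi.single_eq_same]
        rw [show n i + 1 + (h i + 1) = (n i + h i + 1).succ by omega, e3,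
          show n i + (h i + 1) = n i + h i + 1 by omega,
          show n i + 1 + h i = n i + h i + 1 by omega]
        push_cast
        ring
      rw [e4]
      ring

lemma eq_single_zero_of_shift_eq_zero {c : (Fin d → ℕ) →₀ ℤ} (h : ∀ i, shift i c = 0) :
    c = Finsupp.single 0 (c 0) := by
  ext g
  by_cases hg : g = 0
  · simp [hg]
  · obtain ⟨i, g, rfl⟩ := exists_eq_add_single hg
    rw [Finsupp.single_eq_of_ne hg, ← shift_apply, h, Finsupp.zero_apply]

/-- Induction on a bound for the total degree: the differences also vanish eventually, so all shifts
are zero and only a constant is left. -/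
lemma eq_zero_of_eventually_binomPoly_eq_zero {c : (Fin d → ℕ) →₀ ℤ}
    (hc : ∀ᶠ n in atTop, binomPoly c n = 0) : c = 0 := by
  obtain ⟨D, hD⟩ : ∃ D, ∀ h, c h ≠ 0 → ∑ i, h i < D := by
    refine ⟨c.support.sup (fun h => ∑ i, h i) + 1, fun h hh => Nat.lt_succ_of_le ?_⟩
    exact Finset.le_sup (f := fun h : Fin d → ℕ => ∑ i, h i) (Finsupp.mem_support_iff.2 hh)
  induction D generalizing c with
  | zero =>
    ext h
    by_contra hh
    exact absurd (hD h hh) (by simp)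
  | succ D ih =>
    have hs : ∀ i, shift i c = 0 := by
      intro i
      refine ih ?_ fun h hh => ?_
      · rw [← eventually_add_iff (Pi.single i 1)]
        filter_upwards [hc, (eventually_add_iff (Pi.single i 1)).2 hc] with n h1 h2
        have := binomPoly_add_single i c n
        linarith
      · have := hD _ hh
        simp only [Pi.add_apply, Finset.sum_add_distrib] at this
        have h1 : ∑ x, (Pi.single i 1 : Fin d → ℕ) x = 1 := by simp
        omega
    have h0 := eq_single_zero_of_shift_eq_zero hs
    rw [h0] at hc
    obtain ⟨n, hn⟩ := hc.exists
    rw [binomPoly_single_zero] at hn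
    rw [h0, hn, Finsupp.single_zero]

lemma eq_of_eventually_binomPoly_eq {c c' : (Fin d → ℕ) →₀ ℤ}
    (hc : ∀ᶠ n in atTop, binomPoly c n = binomPoly c' n) : c = c' := by
  rw [← sub_eq_zero]
  refine eq_zero_of_eventually_binomPoly_eq_zero ?_
  filter_upwards [hc] with n hn
  rw [binomPoly_sub, hn, sub_self]

lemma exists_shift_eq {c : Fin d → (Fin d → ℕ) →₀ ℤ}
    (hc : ∀ i j, shift j (c i) = shift i (c j)) : ∃ b, ∀ i, shift i b = c i := by
  classical
  -- The compatibility condition makes the prescribed value at an index independent of the unit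
  -- vector removed from it.
  have hwd : ∀ i j (g h : Fin d → ℕ), g + Pi.single i 1 = h + Pi.single j 1 →
      c i g = c j h := by
    intro i j g h e
    rcases eq_or_ne i j with rfl | hij
    · rw [add_right_cancel e]
    · obtain ⟨k, rfl⟩ : ∃ k, g = k + Pi.single j 1 := by
        refine ⟨g - Pi.single j 1, (tsub_add_cancel_of_le ?_).symm⟩
        intro l
        rcases eq_or_ne l j with rfl | hl
        · have := congrFun e l
          simp [hij.symm] at this
          simp [this]
        · simp [hl]
      obtain rfl : k + Pi.single i 1 = h := by
        refine add_right_cancel (b := Pi.single j 1) ?_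
        rw [← e]
        abel
      exact DFunLike.congr_fun (hc i j) k
  -- The default value is used only at `h = 0`; this constant of integration is invisible to every
  -- shift.
  let F : (Fin d → ℕ) → ℤ := fun h =>
    if hh : ∃ (i : Fin d) (g : Fin d → ℕ), h = g + Pi.single i 1 then c hh.choose hh.choose_spec.choose else 0
  have hF : ∀ i g, F (g + Pi.single i 1) = c i g := by
    intro i g
    have hh : ∃ (i' : Fin d) (g' : Fin d → ℕ), g + Pi.single i 1 = g' + Pi.single i' 1 := ⟨i, g, rfl⟩
    simp only [F, dif_pos hh]
    exact (hwd _ _ _ _ hh.choose_spec.choose_spec).symm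
  have hfin : (Function.support F).Finite := by
    refine (Set.finite_iUnion fun i : Fin d =>
      ((c i).support.finite_toSet.image (· + Pi.single i 1))).subset fun h hh => ?_
    by_cases h' : ∃ (i : Fin d) (g : Fin d → ℕ), h = g + Pi.single i 1
    · obtain ⟨i, g, rfl⟩ := h'
      rw [Function.mem_support, hF] at hh
      exact Set.mem_iUnion.2 ⟨i, g, by simpa using hh, rfl⟩
    · exact absurd (dif_neg h') hh
  exact ⟨Finsupp.ofSupportFinite F hfin, fun i => by ext g; exact hF i g⟩

lemma eventually_const_of_eventually_add_single {g : (Fin d → ℕ) → ℤ}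
    (hg : ∀ i, ∀ᶠ n in atTop, g (n + Pi.single i 1) = g n) :
    ∃ a, ∀ᶠ n in atTop, g n = a := by
  obtain ⟨n₀, h₀⟩ := eventually_atTop.1 (eventually_all.2 hg)
  refine ⟨g n₀, eventually_atTop.2 ⟨n₀, fun n hn => ?_⟩⟩
  obtain ⟨m, rfl⟩ := exists_add_of_le hn
  clear hn
  induction hs : ∑ i, m i generalizing m with
  | zero =>
    obtain rfl : m = 0 := by
      ext i
      exact Finset.sum_eq_zero_iff.1 hs i (Finset.mem_univ _)
    simp
  | succ D ih =>
    obtain ⟨i, m, rfl⟩ := exists_eq_add_single (h := m) (by rintro rfl; simp at hs)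
    rw [← add_assoc, h₀ _ le_self_add]
    refine ih _ ?_
    have h1 : ∑ x, (Pi.single i 1 : Fin d → ℕ) x = 1 := by simp
    simp only [Pi.add_apply, Finset.sum_add_distrib] at hs
    omega

/-- Discrete integration: the differences are integrated to one polynomial, from which `f`
eventually differs by a constant. -/
lemma exists_eventually_eq_binomPoly {f : (Fin d → ℕ) → ℤ}
    (hf : ∀ i, ∃ c, ∀ᶠ n in atTop,
      f (n + Pi.single i 1) - f n = binomPoly c (n + Pi.single i 1)) :
    ∃ c, ∀ᶠ n in atTop, f n = binomPoly c n := by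
  choose c hc using hf
  obtain ⟨b, hb⟩ : ∃ b, ∀ i, shift i b = c i := by
    refine exists_shift_eq fun i j => eq_of_eventually_binomPoly_eq ?_
    -- At `n + e_i + e_j` both sides are the mixed second difference of `f`.
    rw [← eventually_add_iff (Pi.single i 1 + Pi.single j 1)]
    filter_upwards [hc i, hc j, (eventually_add_iff (Pi.single j 1)).2 (hc i),
      (eventually_add_iff (Pi.single i 1)).2 (hc j)] with n h1 h2 h3 h4
    have h5 := binomPoly_add_single j (c i) (n + Pi.single i 1)
    have h6 := binomPoly_add_single i (c j) (n + Pi.single j 1)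
    simp only [add_right_comm n (Pi.single j 1) (Pi.single i 1), ← add_assoc] at *
    linarith
  obtain ⟨a, ha⟩ := eventually_const_of_eventually_add_single
    (g := fun n => f n - binomPoly b n) (fun i => by
      filter_upwards [hc i] with n hn
      have := binomPoly_add_single i b n
      rw [hb] at this
      linarith)
  refine ⟨b + Finsupp.single 0 a, ?_⟩
  filter_upwards [ha] with n hn
  rw [binomPoly_add, binomPoly_single_zero]
  linarith

end Numeric

/-! ### Additivity of length. -/

section Length

variable {A V V' : Type*} [CommRing A] [AddCommGroup V] [Module A V] [AddCommGroup V'] [Module A V']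

lemma length_eq_length_inf_ker_add_length_map (f : V →ₗ[A] V') (P : Submodule A V) :
    Module.length A P =
      Module.length A (P ⊓ LinearMap.ker f : Submodule A V) + Module.length A (P.map f) := by
  refine Module.length_eq_add_of_exact
    (Submodule.inclusion (inf_le_left : P ⊓ LinearMap.ker f ≤ P))
    (f.submoduleMap P) (Submodule.inclusion_injective _) (f.submoduleMap_surjective P) ?_
  intro ⟨v, hv⟩
  constructor
  · intro h
    exact ⟨⟨v, hv, congrArg Subtype.val h⟩, rfl⟩
  · rintro ⟨⟨w, hw⟩, h⟩
    obtain rfl : w = v := congrArg Subtype.val h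
    exact Subtype.ext hw.2

/-- The composite `P → V' / Q` has image `(Q + f(P)) / Q` and kernel `P ∩ f⁻¹(Q)`. Written without
subtraction, the identity needs no finiteness. -/
lemma length_sup_map (f : V →ₗ[A] V') (P : Submodule A V) (Q : Submodule A V') :
    Module.length A (Q ⊔ P.map f : Submodule A V') +
        Module.length A (P ⊓ Q.comap f : Submodule A V) =
      Module.length A Q + Module.length A P := by
  have h1 := length_eq_length_inf_ker_add_length_map Q.mkQ (Q ⊔ P.map f)
  have h2 := length_eq_length_inf_ker_add_length_map (Q.mkQ ∘ₗ f) P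
  have h3 : (Q ⊔ P.map f).map Q.mkQ = P.map (Q.mkQ ∘ₗ f) := by
    rw [Submodule.map_sup, Submodule.map_comp, Submodule.mkQ_map_self, bot_sup_eq]
  rw [Submodule.ker_mkQ, inf_eq_right.2 le_sup_left, h3] at h1
  rw [LinearMap.ker_comp, Submodule.ker_mkQ] at h2
  rw [h1, h2]
  ring

end Length

/-! ### Avoiding finitely many proper submodules. -/

section Avoidance

variable {A V : Type*} [CommRing A] [IsLocalRing A] [Infinite (IsLocalRing.ResidueField A)]
  [AddCommGroup V] [Module A V]

lemma exists_notMem_of_ne_top {ι : Type*} (s : Finset ι) (W : ι → Submodule A V)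
    (hW : ∀ j ∈ s, W j ≠ ⊤) : ∃ v, ∀ j ∈ s, v ∉ W j := by
  classical
  induction s using Finset.induction_on with
  | empty => exact ⟨0, by simp⟩
  | insert j₀ s hj₀ ih =>
    obtain ⟨v, hv⟩ := ih fun j hj => hW j (Finset.mem_insert_of_mem hj)
    by_cases hv₀ : v ∈ W j₀
    swap
    · exact ⟨v, Finset.forall_mem_insert _ _ _ |>.2 ⟨hv₀, hv⟩⟩
    obtain ⟨u, hu⟩ : ∃ u, u ∉ W j₀ := by
      by_contra! h
      exact hW j₀ (Finset.mem_insert_self _ _) (Submodule.eq_top_iff'.2 h)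
    -- The line `v + a u` meets `W j` in at most one residue class of `a`: two classes differ by a
    -- unit, which would put `u`, hence `v`, in `W j`.
    have hbad : ∀ j ∈ s, {r | ∃ a, IsLocalRing.residue A a = r ∧ v + a • u ∈ W j}.Subsingleton := by
      rintro j hj _ ⟨a, rfl, ha⟩ _ ⟨b, rfl, hb⟩
      by_contra hab
      have hunit : IsUnit (a - b) := by
        rwa [← ne_eq, ← sub_ne_zero, ← map_sub, IsLocalRing.residue_ne_zero_iff_isUnit] at hab
      have h1 : (a - b) • u ∈ W j := by
        have := sub_mem ha hb
        rwa [add_sub_add_left_eq_sub, ← sub_smul] at this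
      have h2 : u ∈ W j := ((W j).smul_mem_iff_of_isUnit hunit).1 h1
      exact hv j hj ((Submodule.add_mem_iff_left _ ((W j).smul_mem a h2)).1 ha)
    obtain ⟨r, hr⟩ := Set.Infinite.nonempty (Set.Finite.infinite_compl
      ((Set.finite_singleton (0 : IsLocalRing.ResidueField A)).union
        (s.finite_toSet.biUnion fun j hj => (hbad j hj).finite)))
    simp only [Set.mem_compl_iff, Set.mem_union, not_or, Set.mem_iUnion, not_exists,
      Set.mem_ofPred_eq, Set.mem_singleton_iff] at hr
    obtain ⟨a, rfl⟩ := IsLocalRing.residue_surjective r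
    refine ⟨v + a • u, Finset.forall_mem_insert _ _ _ |>.2 ⟨fun h => hu ?_, fun j hj h =>
      hr.2 j hj a ⟨rfl, h⟩⟩⟩
    exact ((W j₀).smul_mem_iff_of_isUnit ((IsLocalRing.residue_ne_zero_iff_isUnit a).1 hr.1)).1
      ((Submodule.add_mem_iff_right _ hv₀).1 h)

end Avoidance

/-! ### Homogeneous submodules and their graded pieces. -/

section Components

variable {d : ℕ} {A S M : Type*} [CommRing A] [CommRing S] [Algebra A S]
  [AddCommGroup M] [Module S M] [Module A M] [IsScalarTower A S M]

/-- The projection of a graded module to its component of degree `n`. -/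
def component (𝓜 : (Fin d → ℕ) → Submodule A M) [DirectSum.Decomposition 𝓜] (n : Fin d → ℕ) :
    M →ₗ[A] M :=
  (𝓜 n).subtype ∘ₗ DirectSum.component A _ (fun n => 𝓜 n) n ∘ₗ
    (DirectSum.decomposeLinearEquiv 𝓜).toLinearMap

variable (𝓜 : (Fin d → ℕ) → Submodule A M) [DirectSum.Decomposition 𝓜]

lemma component_mem (n : Fin d → ℕ) (m : M) : component 𝓜 n m ∈ 𝓜 n :=
  (DirectSum.decompose 𝓜 m n).2

variable {𝓜}

lemma component_of_mem {n : Fin d → ℕ} {m : M} (hm : m ∈ 𝓜 n) : component 𝓜 n m = m :=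
  DirectSum.decompose_of_mem_same 𝓜 hm

lemma component_of_mem_ne {k n : Fin d → ℕ} {m : M} (hm : m ∈ 𝓜 k) (h : k ≠ n) :
    component 𝓜 n m = 0 :=
  DirectSum.decompose_of_mem_ne 𝓜 hm h

variable (𝓜) in
lemma exists_sum_component (m : M) : ∃ s : Finset (Fin d → ℕ), m = ∑ n ∈ s, component 𝓜 n m := by
  classical
  exact ⟨_, (DirectSum.sum_support_decompose 𝓜 m).symm⟩

variable {𝒮 : (Fin d → ℕ) → Submodule A S} [GradedAlgebra 𝒮] [SetLike.GradedSMul 𝒮 𝓜]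

lemma smul_mem_add {i j : Fin d → ℕ} {a : S} {m : M} (ha : a ∈ 𝒮 i) (hm : m ∈ 𝓜 j) :
    a • m ∈ 𝓜 (i + j) :=
  SetLike.GradedSMul.smul_mem ha hm

lemma component_add_smul_of_mem_left {i : Fin d → ℕ} {a : S} (ha : a ∈ 𝒮 i) (n : Fin d → ℕ)
    (m : M) : component 𝓜 (i + n) (a • m) = a • component 𝓜 n m := by
  induction m using DirectSum.Decomposition.inductionOn 𝓜 with
  | zero => simp
  | @homogeneous k m =>
    rcases eq_or_ne k n with rfl | h
    · rw [component_of_mem (smul_mem_add ha m.2), component_of_mem m.2]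
    · rw [component_of_mem_ne (smul_mem_add ha m.2) (by simpa using h),
        component_of_mem_ne m.2 h, smul_zero]
  | add m m' h h' => rw [smul_add, map_add, h, h', map_add, smul_add]

lemma component_add_smul_of_mem_right {k : Fin d → ℕ} {m : M} (hm : m ∈ 𝓜 k) (n : Fin d → ℕ)
    (a : S) : component 𝓜 (n + k) (a • m) = component 𝒮 n a • m := by
  induction a using DirectSum.Decomposition.inductionOn 𝒮 with
  | zero => simp
  | @homogeneous i a =>
    rcases eq_or_ne i n with rfl | h
    · rw [component_of_mem (smul_mem_add a.2 hm), component_of_mem a.2]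
    · rw [component_of_mem_ne (smul_mem_add a.2 hm) (by simpa using h),
        component_of_mem_ne a.2 h, zero_smul]
  | add a a' h h' => rw [add_smul, map_add, h, h', map_add, add_smul]

lemma component_smul_of_mem_right {k : Fin d → ℕ} {m : M} (hm : m ∈ 𝓜 k) (n : Fin d → ℕ)
    (a : S) : component 𝓜 n (a • m) = 0 ∨ k ≤ n ∧
      component 𝓜 n (a • m) = component 𝒮 (n - k) a • m := by
  by_cases h : k ≤ n
  · refine Or.inr ⟨h, ?_⟩
    rw [← component_add_smul_of_mem_right hm, tsub_add_cancel_of_le h]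
  · left
    induction a using DirectSum.Decomposition.inductionOn 𝒮 with
    | zero => simp
    | @homogeneous i a =>
      refine component_of_mem_ne (smul_mem_add a.2 hm) ?_
      rintro rfl
      exact h le_add_self
    | add a a' h h' => rw [add_smul, map_add, h, h', add_zero]

variable (𝓜) in
/-- A submodule of a graded module is homogeneous if it contains the components of its elements. -/
def IsHomog (N : Submodule S M) : Prop := ∀ n, ∀ m ∈ N, component 𝓜 n m ∈ N

lemma isHomog_bot : IsHomog 𝓜 (⊥ : Submodule S M) := by
  rintro n m hm
  rw [(Submodule.mem_bot S).1 hm]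
  simp

lemma isHomog_top : IsHomog 𝓜 (⊤ : Submodule S M) := fun _ _ _ => trivial

lemma IsHomog.sup {N L : Submodule S M} (hN : IsHomog 𝓜 N) (hL : IsHomog 𝓜 L) :
    IsHomog 𝓜 (N ⊔ L) := by
  intro n m hm
  obtain ⟨a, ha, b, hb, rfl⟩ := Submodule.mem_sup.1 hm
  rw [map_add]
  exact Submodule.add_mem_sup (hN n a ha) (hL n b hb)

/-- The submodule `xL` for an element `x`. -/
abbrev mulSub (x : S) (L : Submodule S M) : Submodule S M := L.map (LinearMap.lsmul S M x)

/-- The submodule `N :_L x`. -/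
abbrev colonSub (N L : Submodule S M) (x : S) : Submodule S M :=
  L ⊓ N.comap (LinearMap.lsmul S M x)

lemma IsHomog.mulSub {L : Submodule S M} (hL : IsHomog 𝓜 L) {i : Fin d → ℕ} {x : S}
    (hx : x ∈ 𝒮 i) : IsHomog 𝓜 (mulSub x L) := by
  rintro n _ ⟨m, hm, rfl⟩
  obtain ⟨s, hs⟩ := exists_sum_component 𝓜 m
  rw [hs, LinearMap.lsmul_apply, Finset.smul_sum, map_sum]
  refine Submodule.sum_mem _ fun k _ => ?_
  by_cases h : i + k = n
  · subst h
    rw [component_of_mem (smul_mem_add hx (component_mem _ _ _))]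
    exact ⟨_, hL k m hm, rfl⟩
  · rw [component_of_mem_ne (smul_mem_add hx (component_mem _ _ _)) h]
    exact zero_mem _

lemma IsHomog.colonSub {N L : Submodule S M} (hN : IsHomog 𝓜 N) (hL : IsHomog 𝓜 L)
    {i : Fin d → ℕ} {x : S} (hx : x ∈ 𝒮 i) : IsHomog 𝓜 (colonSub N L x) := by
  rintro n m ⟨hm, hxm⟩
  refine ⟨hL n m hm, ?_⟩
  rw [SetLike.mem_coe, Submodule.mem_comap, LinearMap.lsmul_apply,
    ← component_add_smul_of_mem_left hx]
  exact hN _ _ hxm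

lemma IsHomog.colon {N L : Submodule S M} (hN : IsHomog 𝓜 N) (hL : IsHomog 𝓜 L) :
    IsHomog 𝒮 (N.colon (L : Set M)) := by
  intro n a ha
  rw [Submodule.mem_colon] at ha ⊢
  intro m hm
  obtain ⟨s, hs⟩ := exists_sum_component 𝓜 m
  rw [hs, Finset.smul_sum]
  refine Submodule.sum_mem _ fun k _ => ?_
  rw [← component_add_smul_of_mem_right (component_mem 𝓜 k m)]
  exact hN _ _ (ha _ (hL k m hm))

/-- The component of degree `n` of a submodule. -/
def degPart (𝓜 : (Fin d → ℕ) → Submodule A M) (L : Submodule S M) (n : Fin d → ℕ) :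
    Submodule A M :=
  L.restrictScalars A ⊓ 𝓜 n

lemma degPart_sup_mulSub {N L : Submodule S M} (hN : IsHomog 𝓜 N) (hL : IsHomog 𝓜 L)
    {i : Fin d → ℕ} {x : S} (hx : x ∈ 𝒮 i) (n : Fin d → ℕ) :
    degPart 𝓜 (N ⊔ mulSub x L) (i + n) =
      degPart 𝓜 N (i + n) ⊔ (degPart 𝓜 L n).map (Algebra.lsmul A A M x) := by
  apply le_antisymm
  · rintro _ ⟨hm, hm'⟩
    obtain ⟨a, ha, _, ⟨b, hb, rfl⟩, rfl⟩ := Submodule.mem_sup.1 hm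
    rw [← component_of_mem hm', map_add, LinearMap.lsmul_apply,
      component_add_smul_of_mem_left hx]
    exact Submodule.add_mem_sup ⟨hN _ _ ha, component_mem _ _ _⟩
      ⟨_, ⟨hL _ _ hb, component_mem _ _ _⟩, rfl⟩
  · refine sup_le (inf_le_inf_right _ fun m hm => Submodule.mem_sup_left hm) ?_
    rintro _ ⟨m, ⟨hm, hm'⟩, rfl⟩
    exact ⟨Submodule.mem_sup_right ⟨m, hm, rfl⟩, smul_mem_add hx hm'⟩

lemma length_degPart_add {N L : Submodule S M} (hN : IsHomog 𝓜 N) (hL : IsHomog 𝓜 L)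
    {i : Fin d → ℕ} {x : S} (hx : x ∈ 𝒮 i) (n : Fin d → ℕ) :
    Module.length A (degPart 𝓜 (N ⊔ mulSub x L) (i + n)) +
        Module.length A (degPart 𝓜 (colonSub N L x) n) =
      Module.length A (degPart 𝓜 N (i + n)) + Module.length A (degPart 𝓜 L n) := by
  have h : degPart 𝓜 (colonSub N L x) n =
      degPart 𝓜 L n ⊓ (degPart 𝓜 N (i + n)).comap (Algebra.lsmul A A M x) := by
    ext m
    constructor
    · rintro ⟨⟨h1, h2⟩, h3⟩
      exact ⟨⟨h1, h3⟩, h2, smul_mem_add hx h3⟩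
    · rintro ⟨⟨h1, h3⟩, h2, -⟩
      exact ⟨⟨h1, h2⟩, h3⟩
  rw [degPart_sup_mulSub hN hL hx, h, length_sup_map]

end Components

/-! ### Consequences of standardness. -/

section Standard

variable {d : ℕ} {A S : Type*} [CommRing A] [CommRing S] [Algebra A S]
  {𝒮 : (Fin d → ℕ) → Submodule A S} [GradedAlgebra 𝒮]

/-- The products on the right multiply like a grading, so the elements whose components all lie in
them form a subalgebra; it contains the generators. -/
lemma IsStandard.eq_prod (hS : IsStandard 𝒮) (n : Fin d → ℕ) :
    𝒮 n = ∏ i, 𝒮 (Pi.single i 1) ^ n i := by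
  classical
  set T : (Fin d → ℕ) → Submodule A S := fun n => ∏ i, 𝒮 (Pi.single i 1) ^ n i with hT
  have hTadd : ∀ m n, T (m + n) = T m * T n := by
    intro m n
    simp only [hT, Pi.add_apply, pow_add, Finset.prod_mul_distrib]
  have hT0 : T 0 = 1 := by simp [hT]
  have hTsingle : ∀ i, T (Pi.single i 1) = 𝒮 (Pi.single i 1) := by
    intro i
    rw [hT]
    dsimp only
    rw [Finset.prod_eq_single i]
    · simp
    · intro j _ hj
      simp [hj]
    · simp
  have hmul : ∀ m n, 𝒮 m * 𝒮 n ≤ 𝒮 (m + n) := fun m n =>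
    Submodule.mul_le.2 fun a ha b hb => SetLike.mul_mem_graded ha hb
  have hTle : ∀ n, T n ≤ 𝒮 n := by
    intro n
    induction hs : ∑ i, n i generalizing n with
    | zero =>
      obtain rfl : n = 0 := by
        ext i
        exact Finset.sum_eq_zero_iff.1 hs i (Finset.mem_univ _)
      rw [hT0]
      exact Submodule.one_le.2 SetLike.GradedOne.one_mem
    | succ D ih =>
      obtain ⟨i, m, rfl⟩ := exists_eq_add_single (h := n) (by rintro rfl; simp at hs)
      rw [hTadd, hTsingle]
      refine (mul_le_mul' (ih m ?_) le_rfl).trans (hmul _ _)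
      have h1 : ∑ x, (Pi.single i 1 : Fin d → ℕ) x = 1 := by simp
      simp only [Pi.add_apply, Finset.sum_add_distrib] at hs
      omega
  refine le_antisymm (fun a ha => ?_) (hTle n)
  have key : ∀ a : S, ∀ n, component 𝒮 n a ∈ T n := by
    intro a
    have hof : ∀ k a, a ∈ T k → ∀ n, component 𝒮 n a ∈ T n := by
      intro k a ha n
      rcases eq_or_ne k n with rfl | h
      · rwa [component_of_mem (hTle _ ha)]
      · rw [component_of_mem_ne (hTle _ ha) h]
        exact zero_mem _
    have hmem : a ∈ Algebra.adjoin A (⋃ i : Fin d, (𝒮 (Pi.single i 1) : Set S)) := by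
      rw [hS.2]
      trivial
    induction hmem using Algebra.adjoin_induction with
    | mem a ha =>
      obtain ⟨i, hi⟩ := Set.mem_iUnion.1 ha
      exact hof _ _ ((hTsingle i).symm ▸ hi)
    | algebraMap r =>
      refine hof 0 _ ?_
      rw [hT0]
      exact Submodule.algebraMap_mem r
    | add a b _ _ h h' =>
      intro n
      rw [map_add]
      exact add_mem (h n) (h' n)
    | mul a b _ _ h h' =>
      intro n
      obtain ⟨s, hs⟩ := exists_sum_component 𝒮 a
      obtain ⟨t, ht⟩ := exists_sum_component 𝒮 b
      rw [hs, ht, Finset.sum_mul_sum, map_sum]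
      refine sum_mem fun i _ => ?_
      rw [map_sum]
      refine sum_mem fun j _ => hof (i + j) _ ?_ n
      rw [hTadd]
      exact Submodule.mul_mem_mul (h i) (h' j)
  rw [← component_of_mem ha]
  exact key a n

lemma IsStandard.zero (hS : IsStandard 𝒮) : 𝒮 0 = 1 := by
  rw [hS.eq_prod]
  simp

lemma IsStandard.add (hS : IsStandard 𝒮) (m n : Fin d → ℕ) : 𝒮 (m + n) = 𝒮 m * 𝒮 n := by
  rw [hS.eq_prod, hS.eq_prod m, hS.eq_prod n]
  simp only [Pi.add_apply, pow_add, Finset.prod_mul_distrib]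

lemma IsStandard.mem_pow_irrelevant (hS : IsStandard 𝒮) {t : ℕ} {n : Fin d → ℕ}
    (hn : ∀ i, t ≤ n i) {a : S} (ha : a ∈ 𝒮 n) : a ∈ irrelevant 𝒮 ^ t := by
  induction t generalizing n a with
  | zero => simp
  | succ t ih =>
    obtain ⟨m, rfl⟩ : ∃ m, n = m + 1 :=
      ⟨n - 1, (tsub_add_cancel_of_le fun i => (Nat.le_add_left 1 t).trans (hn i)).symm⟩
    rw [hS.add] at ha
    refine Submodule.mul_induction_on ha (fun b hb c hc => ?_) fun _ _ => add_mem
    rw [pow_succ]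
    refine Ideal.mul_mem_mul (ih (fun i => Nat.le_of_succ_le_succ (hn i)) hb) ?_
    exact Ideal.subset_span (Set.mem_iUnion.2 ⟨⟨1, le_rfl⟩, hc⟩)

lemma IsStandard.irrelevant_le (hS : IsStandard 𝒮) {P : Ideal S} (i : Fin d)
    (h : ∀ a ∈ 𝒮 (Pi.single i 1), a ∈ P) : irrelevant 𝒮 ≤ P := by
  refine Ideal.span_le.2 (Set.iUnion_subset fun ⟨n, hn⟩ a ha => ?_)
  obtain ⟨m, rfl⟩ : ∃ m, n = m + Pi.single i 1 := by
    refine ⟨n - Pi.single i 1, (tsub_add_cancel_of_le fun j => ?_).symm⟩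
    rcases eq_or_ne j i with rfl | hj
    · simpa using hn j
    · simp [hj]
  rw [SetLike.mem_coe, hS.add] at ha
  exact Submodule.mul_induction_on ha (fun b _ c hc => P.mul_mem_left b (h c hc))
    fun _ _ => add_mem

variable {M : Type*} [AddCommGroup M] [Module S M] [Module A M] [IsScalarTower A S M]
  {𝓜 : (Fin d → ℕ) → Submodule A M} [DirectSum.Decomposition 𝓜] [SetLike.GradedSMul 𝒮 𝓜]

/-- An `A`-submodule of `M_n` is recovered from its `S`-span by taking degree `n`, since `S_0` is
the image of `A`. Chains in `M_n` thus embed into chains in `M`. -/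
lemma IsStandard.isNoetherian (hS : IsStandard 𝒮) [IsNoetherian S M] (n : Fin d → ℕ) :
    IsNoetherian A (𝓜 n) := by
  let F : Submodule A (𝓜 n) → Submodule S M := fun W =>
    Submodule.span S (W.map (𝓜 n).subtype : Set M)
  have hF : ∀ (W : Submodule A (𝓜 n)) (v : 𝓜 n), (v : M) ∈ F W → v ∈ W := by
    intro W v hv
    have key : ∀ m ∈ F W, component 𝓜 n m ∈ W.map (𝓜 n).subtype := by
      intro m hm
      induction hm using Submodule.closure_induction with
      | zero => simp
      | add a b _ _ ha hb => rw [map_add]; exact add_mem ha hb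
      | smul_mem r a ha =>
        obtain ⟨w, hw, rfl⟩ := ha
        have h0 : component 𝒮 0 r ∈ (1 : Submodule A S) := hS.zero ▸ component_mem 𝒮 0 r
        obtain ⟨c, hc⟩ := Submodule.mem_one.1 h0
        have h1 := component_add_smul_of_mem_right (𝒮 := 𝒮) w.2 0 r
        rw [zero_add, ← hc, algebraMap_smul] at h1
        change component 𝓜 n (r • (w : M)) ∈ _
        rw [h1]
        exact ⟨c • w, W.smul_mem c hw, rfl⟩
    have := key _ hv
    rw [component_of_mem v.2] at this
    obtain ⟨w, hw, hwv⟩ := this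
    rwa [← Subtype.ext hwv]
  have hmono : StrictMono F := by
    refine Monotone.strictMono_of_injective
      (fun W W' h => Submodule.span_mono (Submodule.map_mono h)) fun W W' h => ?_
    have hle : ∀ W W', F W = F W' → W ≤ W' := fun W W' h v hv =>
      hF W' v (h ▸ Submodule.subset_span ⟨v, hv, rfl⟩)
    exact le_antisymm (hle _ _ h) (hle _ _ h.symm)
  rw [isNoetherian_iff']
  exact hmono.wellFoundedGT

end Standard

/-! ### Homogeneous cores of primes and relevant dimension zero. -/

section PrimeIdeals

variable {d : ℕ} {A S : Type*} [CommRing A] [CommRing S] [Algebra A S]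
  {𝒮 : (Fin d → ℕ) → Submodule A S} [GradedAlgebra 𝒮]

lemma isPrime_homogeneousCore_of_linearOrder {ι : Type*} [AddCommMonoid ι] (lo : LinearOrder ι)
    (h : IsOrderedCancelAddMonoid ι) [dec : DecidableEq ι] {𝒜 : ι → Submodule A S}
    [GradedAlgebra 𝒜] {P : Ideal S} (hP : P.IsPrime) :
    (P.homogeneousCore 𝒜).toIdeal.IsPrime := by
  obtain rfl : dec = lo.toDecidableEq := Subsingleton.elim _ _
  exact hP.homogeneousCore

/-- The leading-term argument needs a total order compatible with addition; the lexicographic order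
replaces the componentwise one. -/
lemma isPrime_homogeneousCore {P : Ideal S} (hP : P.IsPrime) :
    (P.homogeneousCore 𝒮).toIdeal.IsPrime :=
  let lo : LinearOrder (Fin d → ℕ) := (inferInstance : LinearOrder (Lex (Fin d → ℕ)))
  have h : @IsOrderedCancelAddMonoid (Fin d → ℕ) inferInstance lo.toPartialOrder.toPreorder :=
    (inferInstance : IsOrderedCancelAddMonoid (Lex (Fin d → ℕ)))
  isPrime_homogeneousCore_of_linearOrder lo h hP

variable (𝒮) in
/-- Among the homogeneous primes which contain the ideal `J` and do not contain `S_{++}`, there are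
no proper inclusions. -/
def IsDimZero (J : Ideal S) : Prop :=
  ∀ P Q : Ideal S, P.IsPrime → Q.IsPrime → P.IsHomogeneous 𝒮 → Q.IsHomogeneous 𝒮 →
    J ≤ P → P ≤ Q → ¬ irrelevant 𝒮 ≤ Q → P = Q

lemma IsDimZero.mono {J J' : Ideal S} (h : IsDimZero 𝒮 J) (hJ : J ≤ J') : IsDimZero 𝒮 J' :=
  fun P Q hP hQ hP' hQ' h1 => h P Q hP hQ hP' hQ' (hJ.trans h1)

/-- `P` and `Q` need not be homogeneous, but their homogeneous cores are comparable relevant primes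
over `J`, hence equal. -/
lemma IsDimZero.mem_of_le {J : Ideal S} (h : IsDimZero 𝒮 J) (hJ : IsHomog 𝒮 J)
    {P Q : Ideal S} (hP : P ∈ J.minimalPrimes) (hQ : Q.IsPrime) (hPQ : P ≤ Q)
    (hirr : ¬ irrelevant 𝒮 ≤ Q) {x : S} (hx : SetLike.IsHomogeneousElem 𝒮 x) (hxQ : x ∈ Q) :
    x ∈ P := by
  have core_le : ∀ P : Ideal S, (P.homogeneousCore 𝒮).toIdeal ≤ P :=
    fun P => P.toIdeal_homogeneousCore_le 𝒮
  have hJ' : J ≤ (P.homogeneousCore 𝒮).toIdeal := by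
    have := (show J.IsHomogeneous 𝒮 from fun i a ha => hJ i a ha).toIdeal_homogeneousCore_eq_self
    rw [← this]
    exact Ideal.homogeneousCore_mono 𝒮 hP.1.2
  have h1 := h _ _ (isPrime_homogeneousCore hP.1.1) (isPrime_homogeneousCore hQ)
    (P.homogeneousCore 𝒮).isHomogeneous (Q.homogeneousCore 𝒮).isHomogeneous hJ'
    (Ideal.homogeneousCore_mono 𝒮 hPQ) fun h => hirr (h.trans (core_le Q))
  exact core_le P (h1 ▸ Ideal.mem_homogeneousCore_of_homogeneous_of_mem hx hxQ)

end PrimeIdeals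

/-! ### Associated primes and filter-regular elements. -/

section FilterRegular

variable {d : ℕ} {A S M : Type*} [CommRing A] [CommRing S] [Algebra A S]
  [AddCommGroup M] [Module S M] [Module A M] [IsScalarTower A S M]
  {𝒮 : (Fin d → ℕ) → Submodule A S} [GradedAlgebra 𝒮]
  {𝓜 : (Fin d → ℕ) → Submodule A M} [DirectSum.Decomposition 𝓜] [SetLike.GradedSMul 𝒮 𝓜]

lemma annihilator_map_mkQ (N L : Submodule S M) :
    (L.map N.mkQ).annihilator = N.colon (L : Set M) := by
  ext a
  rw [Submodule.mem_annihilator, Submodule.mem_colon]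
  constructor
  · intro h m hm
    rw [← Submodule.Quotient.mk_eq_zero]
    exact h _ ⟨m, hm, rfl⟩
  · rintro h _ ⟨m, hm, rfl⟩
    exact (Submodule.Quotient.mk_eq_zero N).2 (h m hm)

lemma mem_associatedPrimes_of_mem_minimalPrimes_colon [IsNoetherianRing S] [IsNoetherian S M]
    {N L : Submodule S M} {P : Ideal S} (hP : P ∈ (N.colon (L : Set M)).minimalPrimes) :
    P ∈ associatedPrimes S (L.map N.mkQ) := by
  refine Module.associatedPrimes.minimalPrimes_annihilator_subset_associatedPrimes S _ ?_
  rwa [← annihilator_map_mkQ] at hP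

lemma colon_le_of_mem_associatedPrimes {N L : Submodule S M} {P : Ideal S}
    (hP : P ∈ associatedPrimes S (L.map N.mkQ)) : N.colon (L : Set M) ≤ P := by
  rw [← annihilator_map_mkQ]
  exact Submodule.annihilator_top.ge.trans (IsAssociatedPrime.annihilator_le hP)

/-- Far beyond the degrees of finitely many generators of `L`, every coefficient lies in the `t`-th
power of `S_{++}`. -/
lemma eventually_degPart_le_of_pow_le_colon (hS : IsStandard 𝒮) [IsNoetherian S M]
    {N L : Submodule S M} (hL : IsHomog 𝓜 L) {t : ℕ}
    (ht : irrelevant 𝒮 ^ t ≤ N.colon (L : Set M)) :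
    ∀ᶠ n in atTop, degPart 𝓜 L n ≤ degPart 𝓜 N n := by
  classical
  obtain ⟨F, hF⟩ := (isNoetherian_def.1 ‹IsNoetherian S M›) L
  choose s hs using exists_sum_component 𝓜
  refine eventually_atTop.2 ⟨(F.biUnion s).sup id + fun _ => t, fun n hn m hm => ⟨?_, hm.2⟩⟩
  obtain ⟨c, -, hc⟩ := Submodule.mem_span_finset.1 (hF.symm ▸ hm.1 : m ∈ Submodule.span S ↑F)
  change m ∈ N
  rw [← component_of_mem hm.2, ← hc, map_sum]
  refine sum_mem fun f hf => ?_
  have hfL : f ∈ L := hF ▸ Submodule.subset_span hf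
  rw [congrArg (c f • ·) (hs f), Finset.smul_sum, map_sum]
  refine sum_mem fun k hk => ?_
  rcases component_smul_of_mem_right (𝒮 := 𝒮) (component_mem 𝓜 k f) n (c f) with h | ⟨hkn, h⟩
  · rw [h]
    exact zero_mem _
  · rw [h]
    have hk' : k ≤ (F.biUnion s).sup id :=
      Finset.le_sup (f := id) (Finset.mem_biUnion.2 ⟨f, hf, hk⟩)
    refine Submodule.mem_colon.1 (ht (hS.mem_pow_irrelevant (fun i => ?_)
      (component_mem 𝒮 (n - k) (c f)))) _ (hL k f hfL)
    have h1 := hn i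
    have h2 : k i ≤ _ := hk' i
    simp only [Pi.add_apply, Pi.sub_apply] at h1 ⊢
    omega

/-- Minimal primes of the annihilator of `L / N` are associated, so `S_{++}` lies in its radical and
some power kills `L / N`. -/
lemma eventually_degPart_le (hS : IsStandard 𝒮) [IsNoetherianRing S] [IsNoetherian S M]
    {N L : Submodule S M} (hL : IsHomog 𝓜 L)
    (h : ∀ P ∈ associatedPrimes S (L.map N.mkQ), irrelevant 𝒮 ≤ P) :
    ∀ᶠ n in atTop, degPart 𝓜 L n ≤ degPart 𝓜 N n := by
  have hrad : irrelevant 𝒮 ≤ (N.colon (L : Set M)).radical := by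
    rw [← Ideal.sInf_minimalPrimes]
    exact le_sInf fun P hP => h P (mem_associatedPrimes_of_mem_minimalPrimes_colon hP)
  obtain ⟨t, ht⟩ := Ideal.exists_pow_le_of_le_radical_of_fg hrad (IsNoetherian.noetherian _)
  exact eventually_degPart_le_of_pow_le_colon hS hL ht

/-- A prime containing all of `S_{e_i}` contains `S_{++}`, so each relevant associated prime cuts
out a proper submodule of `S_{e_i}`. -/
lemma exists_notMem_associatedPrimes [IsLocalRing A] [Infinite (IsLocalRing.ResidueField A)]
    (hS : IsStandard 𝒮) [IsNoetherianRing S] [IsNoetherian S M] (N L : Submodule S M) (i : Fin d) :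
    ∃ x ∈ 𝒮 (Pi.single i 1), ∀ P ∈ associatedPrimes S (L.map N.mkQ),
      ¬ irrelevant 𝒮 ≤ P → x ∉ P := by
  classical
  obtain ⟨x, hx⟩ := exists_notMem_of_ne_top
    ((associatedPrimes.finite S (L.map N.mkQ)).toFinset.filter (¬ irrelevant 𝒮 ≤ ·))
    (fun P => (P.restrictScalars A).comap (𝒮 (Pi.single i 1)).subtype) (by
      intro P hP htop
      rw [Finset.mem_filter] at hP
      refine hP.2 (hS.irrelevant_le i fun a ha => ?_)
      have : (⟨a, ha⟩ : 𝒮 (Pi.single i 1)) ∈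
        (P.restrictScalars A).comap (𝒮 (Pi.single i 1)).subtype := htop ▸ trivial
      exact this)
  exact ⟨x, x.2, fun P hP h => hx P (by simp [hP, h])⟩

/-- Associated primes of `(N :_L x) / N` are associated to `L / N` and contain `x`, so none is
relevant. -/
lemma eventually_colonSub_le (hS : IsStandard 𝒮) [IsNoetherianRing S] [IsNoetherian S M]
    {N L : Submodule S M} (hN : IsHomog 𝓜 N) (hL : IsHomog 𝓜 L) {i : Fin d → ℕ} {x : S}
    (hx : x ∈ 𝒮 i)
    (h : ∀ P ∈ associatedPrimes S (L.map N.mkQ), ¬ irrelevant 𝒮 ≤ P → x ∉ P) :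
    ∀ᶠ n in atTop, degPart 𝓜 (colonSub N L x) n ≤ degPart 𝓜 N n := by
  refine eventually_degPart_le hS (hN.colonSub hL hx) fun P hP => ?_
  by_contra hirr
  refine h P ?_ hirr (colon_le_of_mem_associatedPrimes hP ?_)
  · exact associatedPrimes.subset_of_injective
      (Submodule.inclusion_injective (Submodule.map_mono (f := N.mkQ) inf_le_left)) hP
  · exact Submodule.mem_colon.2 fun m hm => hm.2

/-- A relevant associated prime of `L / (N + xL)` contains `x` and lies over a minimal prime of the
annihilator of `L / N`. Dimension zero forces `x` into that minimal prime, which is associated and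
was avoided. -/
lemma eventually_degPart_le_sup_mulSub (hS : IsStandard 𝒮) [IsNoetherianRing S] [IsNoetherian S M]
    {N L : Submodule S M} (hN : IsHomog 𝓜 N) (hL : IsHomog 𝓜 L)
    (hdim : IsDimZero 𝒮 (N.colon (L : Set M))) {i : Fin d → ℕ} {x : S} (hx : x ∈ 𝒮 i)
    (h : ∀ P ∈ associatedPrimes S (L.map N.mkQ), ¬ irrelevant 𝒮 ≤ P → x ∉ P) :
    ∀ᶠ n in atTop, degPart 𝓜 L n ≤ degPart 𝓜 (N ⊔ mulSub x L) n := by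
  refine eventually_degPart_le hS hL fun Q hQ => ?_
  by_contra hirr
  have hcolon := colon_le_of_mem_associatedPrimes hQ
  have hxQ : x ∈ Q := hcolon (Submodule.mem_colon.2 fun m hm =>
    Submodule.mem_sup_right ⟨m, hm, rfl⟩)
  have hQ' : Q.IsPrime := IsAssociatedPrime.isPrime hQ
  obtain ⟨P, hP, hPQ⟩ := Ideal.exists_minimalPrimes_le
    ((Submodule.colon_mono le_sup_left subset_rfl).trans hcolon)
  exact h P (mem_associatedPrimes_of_mem_minimalPrimes_colon hP)
    (fun hle => hirr (hle.trans hPQ))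
    (hdim.mem_of_le (hN.colon hL) hP hQ' hPQ hirr ⟨i, hx⟩ hxQ)

end FilterRegular

/-! ### Hilbert polynomials of subquotients. -/

section Hilbert

variable {d : ℕ} {A S M : Type*} [CommRing A] [IsArtinianRing A] [CommRing S] [Algebra A S]
  [AddCommGroup M] [Module S M] [Module A M] [IsScalarTower A S M]
  {𝒮 : (Fin d → ℕ) → Submodule A S} [GradedAlgebra 𝒮]
  {𝓜 : (Fin d → ℕ) → Submodule A M} [DirectSum.Decomposition 𝓜] [SetLike.GradedSMul 𝒮 𝓜]

/-- The Hilbert function of a submodule, with integer values. -/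
noncomputable def hilb (𝓜 : (Fin d → ℕ) → Submodule A M) (L : Submodule S M) (n : Fin d → ℕ) : ℤ :=
  (Module.length A (degPart 𝓜 L n)).toNat

/-- `c` is the family of coefficients of the Hilbert polynomial of the subquotient `L / N`. -/
def IsSubquotCoeff (𝓜 : (Fin d → ℕ) → Submodule A M) (N L : Submodule S M)
    (c : (Fin d → ℕ) →₀ ℤ) : Prop :=
  ∀ᶠ n in atTop, hilb 𝓜 L n - hilb 𝓜 N n = binomPoly c n

lemma IsStandard.length_ne_top (hS : IsStandard 𝒮) [IsNoetherian S M] {n : Fin d → ℕ}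
    {W : Submodule A M} (hW : W ≤ 𝓜 n) : Module.length A W ≠ ⊤ := by
  have := hS.isNoetherian (𝓜 := 𝓜) n
  have : IsNoetherian A W := isNoetherian_of_le hW
  exact Module.length_ne_top

lemma IsStandard.coe_toNat_length (hS : IsStandard 𝒮) [IsNoetherian S M] {n : Fin d → ℕ}
    {W : Submodule A M} (hW : W ≤ 𝓜 n) :
    ((Module.length A W).toNat : ℕ∞) = Module.length A W :=
  ENat.natCast_toNat (hS.length_ne_top hW)

lemma IsStandard.coe_toNat_length_degPart (hS : IsStandard 𝒮) [IsNoetherian S M]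
    (L : Submodule S M) (n : Fin d → ℕ) :
    ((Module.length A (degPart 𝓜 L n)).toNat : ℕ∞) = Module.length A (degPart 𝓜 L n) :=
  hS.coe_toNat_length inf_le_right

lemma hilb_add (hS : IsStandard 𝒮) [IsNoetherian S M] {N L : Submodule S M} (hN : IsHomog 𝓜 N)
    (hL : IsHomog 𝓜 L) {i : Fin d → ℕ} {x : S} (hx : x ∈ 𝒮 i) (n : Fin d → ℕ) :
    hilb 𝓜 (N ⊔ mulSub x L) (n + i) + hilb 𝓜 (colonSub N L x) n =
      hilb 𝓜 N (n + i) + hilb 𝓜 L n := by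
  have h := length_degPart_add hN hL hx n
  rw [← hS.coe_toNat_length_degPart, ← hS.coe_toNat_length_degPart (colonSub N L x),
    ← hS.coe_toNat_length_degPart N, ← hS.coe_toNat_length_degPart L] at h
  rw [add_comm n i, hilb, hilb, hilb, hilb]
  exact_mod_cast h

lemma hilb_mono (hS : IsStandard 𝒮) [IsNoetherian S M] {N L : Submodule S M} (h : N ≤ L)
    (n : Fin d → ℕ) : hilb 𝓜 N n ≤ hilb 𝓜 L n := by
  have h' : degPart 𝓜 N n ≤ degPart 𝓜 L n := inf_le_inf_right _ h
  refine Int.ofNat_le.2 (ENat.toNat_le_toNat ?_ (hS.length_ne_top (𝓜 := 𝓜) inf_le_right))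
  exact Module.length_le_of_injective (Submodule.inclusion h') (Submodule.inclusion_injective h')

lemma hilb_bot (n : Fin d → ℕ) : hilb 𝓜 (⊥ : Submodule S M) n = 0 := by
  have : degPart 𝓜 (⊥ : Submodule S M) n = ⊥ := by
    rw [degPart, Submodule.restrictScalars_bot, bot_inf_eq]
  rw [hilb, this, Module.length_eq_zero]
  rfl

lemma le_colonSub {N L : Submodule S M} (h : N ≤ L) (x : S) : N ≤ colonSub N L x :=
  fun _ hm => ⟨h hm, N.smul_mem x hm⟩

lemma hilb_colonSub {N L : Submodule S M} (hNL : N ≤ L) {x : S} {n : Fin d → ℕ}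
    (h : degPart 𝓜 (colonSub N L x) n ≤ degPart 𝓜 N n) :
    hilb 𝓜 (colonSub N L x) n = hilb 𝓜 N n := by
  rw [hilb, hilb, le_antisymm h (inf_le_inf_right _ (le_colonSub hNL x))]

lemma IsSubquotCoeff.shift (hS : IsStandard 𝒮) [IsNoetherian S M] {N L : Submodule S M}
    (hNL : N ≤ L) (hN : IsHomog 𝓜 N) (hL : IsHomog 𝓜 L) {i : Fin d} {x : S}
    (hx : x ∈ 𝒮 (Pi.single i 1))
    (h : ∀ᶠ n in atTop, degPart 𝓜 (colonSub N L x) n ≤ degPart 𝓜 N n)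
    {c : (Fin d → ℕ) →₀ ℤ} (hc : IsSubquotCoeff 𝓜 N L c) :
    IsSubquotCoeff 𝓜 (N ⊔ mulSub x L) L (shift i c) := by
  rw [IsSubquotCoeff, ← eventually_add_iff (Pi.single i 1)]
  filter_upwards [h, hc, (eventually_add_iff (Pi.single i 1)).2 hc] with n h1 h2 h3
  have h4 := hilb_add hS hN hL hx n
  rw [hilb_colonSub hNL h1] at h4
  have h5 := binomPoly_add_single i c n
  linarith

variable [IsLocalRing A] [Infinite (IsLocalRing.ResidueField A)] [IsNoetherianRing S]

/-- Noetherian induction on `N`: the difference in direction `i` is the Hilbert function of `M / (N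
+ xM)` for a filter-regular `x` of degree `e_i`. -/
lemma exists_isSubquotCoeff_top (hS : IsStandard 𝒮) [IsNoetherian S M] (N : Submodule S M)
    (hN : IsHomog 𝓜 N) : ∃ c, IsSubquotCoeff 𝓜 N ⊤ c := by
  induction N using WellFoundedGT.induction with
  | ind N ih =>
    refine exists_eventually_eq_binomPoly fun i => ?_
    obtain ⟨x, hx, hxP⟩ := exists_notMem_associatedPrimes hS N ⊤ i
    have hreg := eventually_colonSub_le hS hN isHomog_top hx hxP
    have hN' : IsHomog 𝓜 (N ⊔ mulSub x ⊤) := hN.sup (isHomog_top.mulSub hx)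
    by_cases hlt : N < N ⊔ mulSub x ⊤
    · obtain ⟨c, hc⟩ := ih _ hlt hN'
      refine ⟨c, ?_⟩
      filter_upwards [hreg, (eventually_add_iff (Pi.single i 1)).2 hc] with n h1 h2
      have h3 := hilb_add hS hN isHomog_top hx n
      rw [hilb_colonSub le_top h1] at h3
      linarith
    -- Here `x` kills `M / N` and is filter-regular on it, so `M / N` vanishes in large degrees.
    · have hx' : colonSub N ⊤ x = ⊤ := by
        refine eq_top_iff.2 fun m _ => ⟨trivial, ?_⟩
        have : x • m ∈ N ⊔ mulSub x ⊤ := Submodule.mem_sup_right ⟨m, trivial, rfl⟩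
        rwa [← le_sup_left.eq_of_not_lt hlt] at this
      refine ⟨0, ?_⟩
      filter_upwards [hreg, (eventually_add_iff (Pi.single i 1)).2 hreg] with n h1 h2
      have h3 := hilb_colonSub le_top h1
      have h4 := hilb_colonSub le_top h2
      rw [hx'] at h3 h4
      rw [h3, h4, binomPoly_zero]
      ring

lemma exists_isSubquotCoeff (hS : IsStandard 𝒮) [IsNoetherian S M] {N L : Submodule S M}
    (hN : IsHomog 𝓜 N) (hL : IsHomog 𝓜 L) : ∃ c, IsSubquotCoeff 𝓜 N L c := by
  obtain ⟨a, ha⟩ := exists_isSubquotCoeff_top hS N hN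
  obtain ⟨b, hb⟩ := exists_isSubquotCoeff_top hS L hL
  refine ⟨a - b, ?_⟩
  filter_upwards [ha, hb] with n h1 h2
  rw [binomPoly_sub]
  linarith

/-- Filter-regular cuts, chosen according to `k`, move the coefficient to index `0`, where the
polynomial is constant and equals a length. -/
lemma IsSubquotCoeff.nonneg (hS : IsStandard 𝒮) [IsNoetherian S M] {N L : Submodule S M}
    (hNL : N ≤ L) (hN : IsHomog 𝓜 N) (hL : IsHomog 𝓜 L) {c : (Fin d → ℕ) →₀ ℤ}
    (hc : IsSubquotCoeff 𝓜 N L c) {k : Fin d → ℕ} (hk : ∀ h, k < h → c h = 0) : 0 ≤ c k := by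
  induction hs : ∑ i, k i generalizing k c N with
  | zero =>
    obtain rfl : k = 0 := by
      ext i
      exact Finset.sum_eq_zero_iff.1 hs i (Finset.mem_univ _)
    obtain ⟨n, hn⟩ := hc.exists
    have h0 : c = Finsupp.single 0 (c 0) := eq_single_zero_of_shift_eq_zero fun i => by
      ext h
      exact hk _ (pos_iff_ne_zero.2 (add_single_ne_zero h i))
    rw [h0, binomPoly_single_zero] at hn
    rw [← hn, sub_nonneg]
    exact hilb_mono hS hNL n
  | succ D ih =>
    obtain ⟨i, k, rfl⟩ := exists_eq_add_single (h := k) (by rintro rfl; simp at hs)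
    obtain ⟨x, hx, hxP⟩ := exists_notMem_associatedPrimes hS N L i
    refine ih (sup_le hNL ?_) (hN.sup (hL.mulSub hx))
      (hc.shift hS hNL hN hL hx (eventually_colonSub_le hS hN hL hx hxP))
      (fun h hh => hk _ (by simpa using hh)) ?_
    · rintro _ ⟨m, hm, rfl⟩
      exact L.smul_mem x hm
    · have h1 : ∑ x, (Pi.single i 1 : Fin d → ℕ) x = 1 := by simp
      simp only [Pi.add_apply, Finset.sum_add_distrib] at hs
      omega

lemma IsSubquotCoeff.eq_single_of_isDimZero (hS : IsStandard 𝒮) [IsNoetherian S M]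
    {N L : Submodule S M} (hNL : N ≤ L) (hN : IsHomog 𝓜 N) (hL : IsHomog 𝓜 L)
    (hdim : IsDimZero 𝒮 (N.colon (L : Set M))) {c : (Fin d → ℕ) →₀ ℤ}
    (hc : IsSubquotCoeff 𝓜 N L c) : c = Finsupp.single 0 (c 0) := by
  refine eq_single_zero_of_shift_eq_zero fun i => ?_
  obtain ⟨x, hx, hxP⟩ := exists_notMem_associatedPrimes hS N L i
  have h1 := hc.shift hS hNL hN hL hx (eventually_colonSub_le hS hN hL hx hxP)
  refine eq_zero_of_eventually_binomPoly_eq_zero ?_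
  filter_upwards [h1, eventually_degPart_le_sup_mulSub hS hN hL hdim hx hxP] with n h2 h3
  have hle : N ⊔ mulSub x L ≤ L := by
    refine sup_le hNL ?_
    rintro _ ⟨m, hm, rfl⟩
    exact L.smul_mem x hm
  rw [← h2, hilb, hilb, le_antisymm h3 (inf_le_inf_right _ hle), sub_self]

/-- For `x` in degree `e_i`, the coefficients of `L / N`, `L / (N + xL)` and `(N :_L x) / N`. -/
lemma IsSubquotCoeff.shift_eq (hS : IsStandard 𝒮) [IsNoetherian S M] {N L : Submodule S M}
    (hN : IsHomog 𝓜 N) (hL : IsHomog 𝓜 L) {i : Fin d} {x : S} (hx : x ∈ 𝒮 (Pi.single i 1))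
    {a b e : (Fin d → ℕ) →₀ ℤ} (ha : IsSubquotCoeff 𝓜 N L a)
    (hb : IsSubquotCoeff 𝓜 (N ⊔ mulSub x L) L b) (he : IsSubquotCoeff 𝓜 N (colonSub N L x) e) :
    MixedMult.shift i a = b - (e - MixedMult.shift i e) := by
  refine eq_of_eventually_binomPoly_eq ?_
  rw [← eventually_add_iff (Pi.single i 1)]
  filter_upwards [ha, he, (eventually_add_iff (Pi.single i 1)).2 ha,
    (eventually_add_iff (Pi.single i 1)).2 hb,
    (eventually_add_iff (Pi.single i 1)).2 he] with n h1 h2 h3 h4 h5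
  have h6 := hilb_add hS hN hL hx n
  have h7 := binomPoly_add_single i a n
  have h8 := binomPoly_add_single i e n
  rw [binomPoly_sub, binomPoly_sub]
  linarith

lemma isSubquotCoeff_le_of_isDimZero (hS : IsStandard 𝒮) [IsNoetherian S M] (l : List (S × Fin d))
    (hl : ∀ p ∈ l, p.1 ∈ 𝒮 (Pi.single p.2 1)) {N L : Submodule S M}
    (hNL : N ≤ L) (hN : IsHomog 𝓜 N) (hL : IsHomog 𝓜 L)
    (hdim : IsDimZero 𝒮 (N.colon (L : Set M) ⊔ Ideal.ofList (l.map Prod.fst)))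
    {c : (Fin d → ℕ) →₀ ℤ} (hc : IsSubquotCoeff 𝓜 N L c) :
    (∀ h, (l.map fun p => (Pi.single p.2 1 : Fin d → ℕ)).sum < h → c h = 0) ∧
    ∀ᶠ n in atTop, c (l.map fun p => (Pi.single p.2 1 : Fin d → ℕ)).sum ≤
      hilb 𝓜 L n - hilb 𝓜 (N ⊔ Ideal.ofList (l.map Prod.fst) • L) n := by
  induction l generalizing N L c with
  | nil =>
    simp only [List.map_nil, List.sum_nil, Ideal.ofList_nil, sup_bot_eq, Submodule.bot_smul]
      at hdim ⊢
    have h0 := hc.eq_single_of_isDimZero hS hNL hN hL hdim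
    refine ⟨fun h hh => ?_, ?_⟩
    · rw [h0, Finsupp.single_eq_of_ne hh.ne']
    · filter_upwards [hc] with n hn
      rw [hn, h0, binomPoly_single_zero]
      simp
  | cons p l ih =>
    obtain ⟨x, i⟩ := p
    have hx : x ∈ 𝒮 (Pi.single i 1) := hl _ List.mem_cons_self
    have hl' : ∀ p ∈ l, p.1 ∈ 𝒮 (Pi.single p.2 1) := fun p hp => hl p (List.mem_cons_of_mem _ hp)
    simp only [List.map_cons, List.sum_cons, Ideal.ofList_cons] at hdim ⊢
    set k := (l.map fun p => (Pi.single p.2 1 : Fin d → ℕ)).sum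
    have hle : mulSub x L ≤ L := by
      rintro _ ⟨m, hm, rfl⟩
      exact L.smul_mem x hm
    have hN' : IsHomog 𝓜 (N ⊔ mulSub x L) := hN.sup (hL.mulSub hx)
    have hK : IsHomog 𝓜 (colonSub N L x) := hN.colonSub hL hx
    obtain ⟨b, hb⟩ := exists_isSubquotCoeff hS hN' hL
    obtain ⟨e, he⟩ := exists_isSubquotCoeff hS hN hK
    have heq := hc.shift_eq hS hN hL hx hb he
    -- Passing to either piece puts `x` into the annihilator, so dropping `x` from the list
    -- preserves dimension zero.
    obtain ⟨hb1, hb2⟩ := ih hl' (sup_le hNL hle) hN' hL (hdim.mono (by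
      rw [← sup_assoc]
      refine sup_le_sup_right (sup_le (Submodule.colon_mono le_sup_left subset_rfl) ?_) _
      rw [Ideal.span_singleton_le_iff_mem, Submodule.mem_colon]
      exact fun m hm => Submodule.mem_sup_right ⟨m, hm, rfl⟩)) hb
    obtain ⟨he1, -⟩ := ih hl' (le_colonSub hNL x) hN hK (hdim.mono (by
      rw [← sup_assoc]
      refine sup_le_sup_right (sup_le (Submodule.colon_mono le_rfl inf_le_left) ?_) _
      rw [Ideal.span_singleton_le_iff_mem, Submodule.mem_colon]
      exact fun m hm => hm.2)) he
    have happly : ∀ h, c (h + Pi.single i 1) = b h - (e h - e (h + Pi.single i 1)) :=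
      fun h => DFunLike.congr_fun heq h
    have hlt : ∀ h, h < h + (Pi.single i 1 : Fin d → ℕ) := fun h =>
      lt_add_of_pos_right h (pos_iff_ne_zero.2 (by simp))
    rw [add_comm _ k]
    refine ⟨fun h hh => ?_, ?_⟩
    · obtain ⟨h, rfl⟩ : ∃ h', h = h' + Pi.single i 1 :=
        ⟨h - Pi.single i 1, (tsub_add_cancel_of_le (le_add_self.trans hh.le)).symm⟩
      have hk : k < h := by simpa using hh
      rw [happly, hb1 h hk, he1 h hk, he1 _ (hk.trans (hlt h))]
      simp
    -- The term `e (k + e_i)` vanishes and `e k` is a nonnegative top coefficient.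
    · have hck : c (k + Pi.single i 1) ≤ b k := by
        rw [happly, he1 _ (hlt k)]
        have := he.nonneg hS (le_colonSub hNL x) hN hK he1
        linarith
      filter_upwards [hb2] with n hn
      rw [Submodule.sup_smul, Submodule.ideal_span_singleton_smul, ← sup_assoc]
      exact hck.trans hn

end Hilbert

/-! ### Translation to the definitions of the theorem. -/

section Main

variable {d : ℕ} {A S M : Type*} [CommRing A] [CommRing S] [Algebra A S]
  [AddCommGroup M] [Module S M] [Module A M] [IsScalarTower A S M]
  {𝒮 : (Fin d → ℕ) → Submodule A S} [GradedAlgebra 𝒮]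
  {𝓜 : (Fin d → ℕ) → Submodule A M} [DirectSum.Decomposition 𝓜] [SetLike.GradedSMul 𝒮 𝓜]

lemma degPart_top (n : Fin d → ℕ) : degPart 𝓜 (⊤ : Submodule S M) n = 𝓜 n := by
  rw [degPart, Submodule.restrictScalars_top, top_inf_eq]

/-- For finite `M`, the support of `M / XM` is the zero locus of the annihilator of `M` together
with `X`. -/
lemma isDimZero_of_dimSuppPP_le_zero [Module.Finite S M] {X : Set S}
    (h : dimSuppPP 𝒮 (M ⧸ idealMul M X) ≤ 0) :
    IsDimZero 𝒮 ((⊥ : Submodule S M).colon ((⊤ : Submodule S M) : Set M) ⊔ Ideal.span X) := by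
  intro P Q hP hQ hP' hQ' hJ hPQ hirr
  have hsupp : Module.support S (M ⧸ idealMul M X) =
      Module.support S M ∩ PrimeSpectrum.zeroLocus (Ideal.span X) := Module.support_quotient _
  have key : ∀ P' : PrimeSpectrum S, P ≤ P'.asIdeal → P'.asIdeal ≤ Q →
      P'.asIdeal.IsHomogeneous 𝒮 → P' ∈ suppPP 𝒮 (M ⧸ idealMul M X) := by
    intro P' h1 h2 h3
    refine ⟨⟨h3, fun h => hirr (h.trans h2)⟩, ?_⟩
    rw [hsupp, Module.support_eq_zeroLocus]
    refine ⟨?_, le_sup_right.trans (hJ.trans h1)⟩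
    rw [Submodule.bot_colon, Submodule.annihilator_top] at hJ
    exact le_sup_left.trans (hJ.trans h1)
  have h1 := Order.krullDim_nonpos_iff_forall_isMax.1 h ⟨⟨P, hP⟩, key ⟨P, hP⟩ le_rfl hPQ hP'⟩
  exact le_antisymm hPQ (h1 (b := ⟨⟨Q, hQ⟩, key ⟨Q, hQ⟩ hPQ le_rfl hQ'⟩) hPQ)

lemma idealMul_image_succ {s : ℕ} (x : Fin s → S) (i : Fin s) :
    idealMul M (x '' {j | j.val < i.val + 1}) =
      idealMul M (x '' {j | j.val < i.val}) ⊔ mulSub (x i) ⊤ := by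
  have : {j : Fin s | j.val < i.val + 1} = insert i {j | j.val < i.val} := by
    ext j
    simp only [Set.mem_ofPred_eq, Set.mem_insert_iff, Fin.ext_iff]
    omega
  rw [this, Set.image_insert_eq, idealMul, Ideal.span_insert, Submodule.sup_smul,
    Submodule.ideal_span_singleton_smul, sup_comm]
  rfl

variable [IsArtinianRing A]

lemma length_quotGrading (hS : IsStandard 𝒮) [IsNoetherian S M] (N : Submodule S M)
    (n : Fin d → ℕ) :
    ∃ l : ℕ, Module.length A (quotGrading 𝓜 N n) = l ∧ (l : ℤ) = hilb 𝓜 (⊤ : Submodule S M) n - hilb 𝓜 N n := by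
  have h := length_eq_length_inf_ker_add_length_map (N.mkQ.restrictScalars A) (𝓜 n)
  have hker : 𝓜 n ⊓ LinearMap.ker (N.mkQ.restrictScalars A) = degPart 𝓜 N n := by
    ext m
    simp [degPart, and_comm]
  rw [hker, ← degPart_top (S := S) (𝓜 := 𝓜) n] at h
  have h1 : Module.length A ((degPart 𝓜 (⊤ : Submodule S M) n).map (N.mkQ.restrictScalars A)) ≠ ⊤ :=
    fun htop => hS.length_ne_top (W := degPart 𝓜 (⊤ : Submodule S M) n) inf_le_right
      (by rw [h, htop, add_top])
  obtain ⟨l, hl⟩ := ENat.ne_top_iff_exists.1 h1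
  rw [← hS.coe_toNat_length_degPart, ← hS.coe_toNat_length_degPart N, ← hl] at h
  refine ⟨l, ?_, ?_⟩
  · rw [quotGrading, ← degPart_top (S := S) (𝓜 := 𝓜) n, hl]
  · rw [hilb, hilb]
    have : (Module.length A (degPart 𝓜 (⊤ : Submodule S M) n)).toNat =
      (Module.length A (degPart 𝓜 N n)).toNat + l := by exact_mod_cast h
    omega

lemma isHilbertCoeff_iff (hS : IsStandard 𝒮) [IsNoetherian S M] (c : (Fin d → ℕ) →₀ ℤ) :
    IsHilbertCoeff 𝓜 c ↔ IsSubquotCoeff 𝓜 (⊥ : Submodule S M) ⊤ c := by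
  refine eventually_congr (Eventually.of_forall fun n => ?_)
  have h := hS.coe_toNat_length_degPart (𝓜 := 𝓜) ⊤ n
  rw [hilb_bot, sub_zero, hilb, ← degPart_top (S := S) (𝓜 := 𝓜) n, ← h]
  constructor
  · rintro ⟨l, hl, hc⟩
    rw [← hc]
    exact_mod_cast hl
  · exact fun hc => ⟨_, rfl, hc⟩

/-- Each element of the sequence is filter-regular modulo its predecessors, so the cuts compose to a
single translation of indices. -/
lemma exists_isSubquotCoeff_of_isFilterRegularSeq (hS : IsStandard 𝒮) [IsNoetherian S M] {s : ℕ}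
    {x : Fin s → S} {e : Fin s → Fin d} (hx : ∀ j, x j ∈ 𝒮 (Pi.single (e j) 1))
    (hreg : IsFilterRegularSeq 𝒮 𝓜 x) {c : (Fin d → ℕ) →₀ ℤ}
    (hc : IsSubquotCoeff 𝓜 (⊥ : Submodule S M) ⊤ c) {i : ℕ} (hi : i ≤ s) :
    IsHomog 𝓜 (idealMul M (x '' {j | j.val < i})) ∧
      ∃ b, IsSubquotCoeff 𝓜 (idealMul M (x '' {j | j.val < i})) ⊤ b ∧
        ∀ h, b h = c (h + ∑ j with j.val < i, Pi.single (e j) 1) := by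
  induction i with
  | zero =>
    have : idealMul M (x '' {j | j.val < 0}) = ⊥ := by simp [idealMul]
    rw [this]
    exact ⟨isHomog_bot, c, hc, by simp⟩
  | succ i ih =>
    obtain ⟨hN, b, hb, hbc⟩ := ih (Nat.le_of_succ_le hi)
    have hsucc := idealMul_image_succ (M := M) x ⟨i, hi⟩
    dsimp only at hsucc
    rw [hsucc]
    have hxi := hx ⟨i, hi⟩
    refine ⟨hN.sup (isHomog_top.mulSub hxi), _, hb.shift hS le_top hN isHomog_top hxi ?_,
      fun h => ?_⟩
    · filter_upwards [(hreg ⟨i, hi⟩).2] with n hn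
      rintro m ⟨⟨-, hm⟩, hm'⟩
      refine ⟨?_, hm'⟩
      have := hn _ ⟨m, hm', rfl⟩ ((Submodule.Quotient.mk_eq_zero _).2 hm)
      exact (Submodule.Quotient.mk_eq_zero _).1 this
    · have hfilter : Finset.univ.filter (fun j : Fin s => j.val < i + 1) =
          insert ⟨i, hi⟩ (Finset.univ.filter fun j : Fin s => j.val < i) := by
        ext j
        simp only [Finset.mem_filter, Finset.mem_insert, Finset.mem_univ, true_and, Fin.ext_iff]
        omega
      rw [shift_apply, hbc, hfilter, Finset.sum_insert (by simp), add_assoc]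

lemma sum_single_eq {s : ℕ} {e : Fin s → Fin d} {k : Fin d → ℕ}
    (hk : ∀ i, (Finset.univ.filter fun j => e j = i).card = k i) :
    ∑ j, (Pi.single (e j) 1 : Fin d → ℕ) = k := by
  ext i
  rw [Finset.sum_apply, ← hk, Finset.card_filter]
  simp only [Pi.single_apply, eq_comm]

end Main

end MixedMult

theorem mainTheorem4 {d : ℕ} (hd : 0 < d)
    {A : Type*} [CommRing A] [IsLocalRing A] [IsArtinianRing A]
    [Infinite (IsLocalRing.ResidueField A)]
    {S : Type*} [CommRing S] [Algebra A S]
    (𝒮 : (Fin d → ℕ) → Submodule A S) [GradedAlgebra 𝒮] (hS : MixedMult.IsStandard 𝒮)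
    {M : Type*} [AddCommGroup M] [Module S M] [Module A M] [IsScalarTower A S M]
    [Module.Finite S M]
    (𝓜 : (Fin d → ℕ) → Submodule A M) [DirectSum.Decomposition 𝓜] [SetLike.GradedSMul 𝒮 𝓜]
    (k : Fin d → ℕ) {s : ℕ} (x : Fin s → S) (hx : MixedMult.IsMixedMultSystem 𝒮 M x k) :
    (∃! c, MixedMult.IsHilbertCoeff 𝓜 c) ∧
    MixedMult.MixedMultDefined 𝓜 k ∧
    (∀ᶠ n in Filter.atTop, ∃ l : ℕ,
      Module.length A
        (MixedMult.quotGrading 𝓜 (MixedMult.idealMul M (Set.range x)) n) = l ∧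
      MixedMult.mixedCoeff 𝓜 k ≤ (l : ℤ)) ∧
    (MixedMult.IsFilterRegularSeq 𝒮 𝓜 x →
      ∀ᶠ n in Filter.atTop, ∃ l : ℕ,
        Module.length A
          (MixedMult.quotGrading 𝓜 (MixedMult.idealMul M (Set.range x)) n) = l ∧
        MixedMult.mixedCoeff 𝓜 k = (l : ℤ)) := by
  open MixedMult in
  have : Algebra.FiniteType A S := hS.1
  have : IsNoetherianRing S := Algebra.FiniteType.isNoetherianRing A S
  obtain ⟨⟨e, hxe, hek⟩, hdim⟩ := hx
  have hD := isDimZero_of_dimSuppPP_le_zero hdim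
  obtain ⟨c, hc⟩ := exists_isSubquotCoeff (𝓜 := 𝓜) hS (isHomog_bot (S := S)) isHomog_top
  have hc' := (isHilbertCoeff_iff hS c).2 hc
  have huniq : ∀ b, IsHilbertCoeff 𝓜 b → b = c := by
    intro b hb
    refine eq_of_eventually_binomPoly_eq ?_
    filter_upwards [(isHilbertCoeff_iff hS b).1 hb, hc] with n h1 h2
    rw [← h1, h2]
  have hmixed : mixedCoeff 𝓜 = c := by
    have hex : ∃ b, IsHilbertCoeff 𝓜 b := ⟨c, hc'⟩
    rw [mixedCoeff, dif_pos hex]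
    exact huniq _ hex.choose_spec
  have hlist := isSubquotCoeff_le_of_isDimZero (𝓜 := 𝓜) hS (List.ofFn fun j => (x j, e j))
    (fun p hp => by
      obtain ⟨j, rfl⟩ := (List.mem_ofFn' _ _).1 hp
      exact hxe j) bot_le isHomog_bot isHomog_top
  have hideal : Ideal.ofList ((List.ofFn fun j => (x j, e j)).map Prod.fst) =
      Ideal.span (Set.range x) := by
    rw [Ideal.ofList, List.map_ofFn]
    congr 1
    ext a
    simp [List.mem_ofFn]
  have hsum : ((List.ofFn fun j => (x j, e j)).map
      fun p => (Pi.single p.2 1 : Fin d → ℕ)).sum = k := by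
    rw [List.map_ofFn, List.sum_ofFn, ← sum_single_eq hek]
    rfl
  rw [hideal, hsum] at hlist
  obtain ⟨h1, h2⟩ := hlist hD hc
  rw [bot_sup_eq] at h2
  refine ⟨⟨c, hc', huniq⟩, fun h hh => by rw [hmixed, h1 h hh], ?_, fun hreg => ?_⟩
  · filter_upwards [h2] with n hn
    obtain ⟨l, hl, hl'⟩ := length_quotGrading (𝓜 := 𝓜) hS (idealMul M (Set.range x)) n
    exact ⟨l, hl, by rw [hmixed, hl']; exact hn⟩
  · obtain ⟨hN, b, hb, hbc⟩ := exists_isSubquotCoeff_of_isFilterRegularSeq hS hxe hreg hc le_rfl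
    have huniv : {j : Fin s | j.val < s} = Set.univ := by ext j; simp
    rw [huniv, Set.image_univ] at hN hb
    -- The Hilbert polynomial of `M / xM` is constant, and after all the shifts its value is the
    -- coefficient of `M` at `k`.
    have hb0 := hb.eq_single_of_isDimZero hS le_top hN isHomog_top (hD.mono (sup_le
      (Submodule.colon_mono bot_le subset_rfl) fun a ha => Submodule.mem_colon.2 fun m hm =>
        Submodule.smul_mem_smul ha hm))
    have hbk : b 0 = c k := by
      rw [hbc, zero_add, ← sum_single_eq hek]
      simp
    filter_upwards [hb] with n hn
    obtain ⟨l, hl, hl'⟩ := length_quotGrading (𝓜 := 𝓜) hS (idealMul M (Set.range x)) n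
    refine ⟨l, hl, ?_⟩
    rw [hmixed, hl', hn, hb0, binomPoly_single_zero, hbk]
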